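/- Let $\mathbb{F}_q$ be a finite field of characteristic $p$ with $q$ elements, $A=\mathbb{F}_q[\theta]$, $K=\mathbb{F}_q(\theta)$, $K_\infty$ the completion of $K$ for the $\theta^{-1}$-adic valuation, with $|\theta|=q$, and $\mathbb{C}_\infty$ the completion of an algebraic closure of $K_\infty$ for the unique extension of the absolute value. For $d\ge 0$ let $A^+(d)$ be the set of monic polynomials of degree $d$ in $A$. For $t\in\mathbb{C}_\infty$ let $\chi_t:A\to\mathbb{C}_\infty$ be the ring homomorphism $a\mapsto a(t)$ ($\mathbb{F}_q$-linear with $\chi_t(\theta)=t$). For $a\in A$ monic set $\langle a\rangle=a/\theta^{\deg a}$, and for $y\in\mathbb{Z}_p$ $$\langle a\rangle^y=\sum_{j\ge 0}\binom{y}{j}(\langle a\rangle-1)^j,\qquad \binom{y}{j}=\prod_i\binom{y_i}{j_i},$$ where $y=\sum_i y_ip^i$ and $j=\sum_i j_ip^i$ are the $p$-adic expansions, with digits in $\{0,\dots,p-1\}$. Let $\mathbb{S}_\infty=\mathbb{C}_\infty^\times\times\mathbb{Z}_p$. A function $f:\mathbb{C}_\infty^n\to\mathbb{C}_\infty$ is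 called (rigid analytic) entire if there are coefficients $c_k\in\mathbb{C}_\infty$ ($k\in\mathbb{N}^n$) such that $|c_k|R^{|k|}\to 0$ for every real $R\ge 0$, where $|k|=k_1+\dots+k_n$, and $f(t)=\sum_k c_kt^k$ for all $t\in\mathbb{C}_\infty^n$. A function $f:\mathbb{C}_\infty^s\times\mathbb{S}_\infty\to\mathbb{C}_\infty$ is called continuous-analytic (in the sense of Goss) if it is continuous; for every $y\in\mathbb{Z}_p$ there is an entire function $g_y:\mathbb{C}_\infty^{s+1}\to\mathbb{C}_\infty$ with $f(t,x,y)=g_y(x^{-1},t)$ for all $t\in\mathbb{C}_\infty^s$ and $x\in\mathbb{C}_\infty^\times$; and this family depends continuously on $y$ for uniform convergence on bounded sets, that is, for every real $R$ and every $y\in\mathbb{Z}_p$, $f(t,x,y')\to f(t,x,y)$ as $y'\to y$, uniformly for $|t_1|,\dots,|t_s|,|x^{-1}|\le R$. **Proposition.** Let $s\ge 0$ be an integer. The series $$L(\chi_{t_1}\cdots\chi_{t_s};x,y)=\sum_{d\ge 0}x^{-d}\sum_{a\in A^+(d)}\chi_{t_1}(a)\cdots\chi_{t_s}(a)\langle a\rangle^y$$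 converges for all $(t_1,\dots,t_s)\in\mathbb{C}_\infty^s$ and all $(x,y)\in\mathbb{S}_\infty$, and its sum is a continuous-analytic function on $\mathbb{C}_\infty^s\times\mathbb{S}_\infty$ in the sense of Goss. In particular, for every integer $\alpha>0$ and all integers $M_1,\dots,M_s\ge 0$, the series $$L(\chi_{t_1}^{M_1}\cdots\chi_{t_s}^{M_s},\alpha)=\sum_{d\ge 0}\sum_{a\in A^+(d)}\chi_{t_1}(a)^{M_1}\cdots\chi_{t_s}(a)^{M_s}a^{-\alpha}$$ converges for all $(t_1,\dots,t_s)\in\mathbb{C}_\infty^s$ and its sum is an entire function of $(t_1,\dots,t_s)$. -/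

import Mathlib

open Filter Topology Polynomial
open scoped NNReal WithZero

noncomputable section

namespace GossL

/-! ### The fields `K = F(θ)`, `K_∞`, `ℂ_∞` for a finite field `F` -/

section Fields

variable (F : Type*) [Field F]

/-- `K_∞`: the completion of `K = F(θ)` for the `θ⁻¹`-adic valuation. -/
abbrev KInfty : Type _ := @RatFunc.CompletionAtInfty F _ (Classical.decEq _)

lemma v_algebraMap (r : RatFunc F) :
    (Valued.v (algebraMap (RatFunc F) (KInfty F) r) : ℤᵐ⁰)
      = @RatFunc.inftyValuation F _ (Classical.decEq _) r := by
  let _ : DecidableEq (RatFunc F) := Classical.decEq _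
  let _ := RatFunc.inftyValued F
  exact Valued.extensionValuation_apply_coe (K := RatFunc F) r

variable [Finite F]

lemma one_lt_card : (1 : ℝ≥0) < (Nat.card F : ℝ≥0) := by
  exact_mod_cast Finite.one_lt_card (α := F)

/-- The valuation of `K_∞` is made real-valued so that the absolute value of `θ` is
`q = #F`. -/
instance rankOneKInfty : Valuation.RankOne (Valued.v : Valuation (KInfty F) ℤᵐ⁰) where
  hom' := (WithZeroMulInt.toNNReal (one_lt_card F).ne_zero).comp
    MonoidWithZeroHom.ValueGroup₀.embedding
  strictMono' := (WithZeroMulInt.toNNReal_strictMono (one_lt_card F)).comp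
    MonoidWithZeroHom.ValueGroup₀.embedding_strictMono
  exists_val_nontrivial := ⟨algebraMap (RatFunc F) (KInfty F) RatFunc.X, by
    rw [v_algebraMap]; simp⟩

instance normedKInfty : NontriviallyNormedField (KInfty F) :=
  Valued.toNontriviallyNormedField (KInfty F) ℤᵐ⁰

instance ultraKInfty : IsUltrametricDist (KInfty F) :=
  Valued.instIsUltrametricDist (KInfty F) ℤᵐ⁰

instance completeKInfty : CompleteSpace (KInfty F) := by
  let _ : DecidableEq (RatFunc F) := Classical.decEq _
  let _ := RatFunc.inftyValued F
  exact inferInstanceAs (CompleteSpace (UniformSpace.Completion (RatFunc F)))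

/-- An algebraic closure of `K_∞`. -/
abbrev KInftyAlg : Type _ := AlgebraicClosure (KInfty F)

/-- The unique extension of the absolute value of `K_∞` to its algebraic closure. -/
instance normedKInftyAlg : NormedField (KInftyAlg F) :=
  spectralNorm.normedField (KInfty F) (KInftyAlg F)

/-- `ℂ_∞`: the completion of the algebraic closure of `K_∞`, with the extended absolute value. -/
abbrev CInfty : Type _ := UniformSpace.Completion (KInftyAlg F)

/-- The embedding of `K = F(θ)` in `ℂ_∞`. -/
def embK : RatFunc F →+* CInfty F :=
  (algebraMap (KInftyAlg F) (CInfty F)).comp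
    ((algebraMap (KInfty F) (KInftyAlg F)).comp (algebraMap (RatFunc F) (KInfty F)))

/-- The embedding of `A = F[θ]` in `ℂ_∞`. -/
def embA : F[X] →+* CInfty F := (embK F).comp (algebraMap F[X] (RatFunc F))

/-- The element `θ` of `ℂ_∞`. -/
def theta : CInfty F := embA F X

/-- `χ_t : A → ℂ_∞`, the ring homomorphism with `χ_t(θ) = t` that is the identity on `F`;
so `χ_t(a) = a(t)`. -/
def chi (t : CInfty F) : F[X] →+* CInfty F :=
  Polynomial.eval₂RingHom ((embA F).comp C) t

end Fields

/-! ### The `L`-series -/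

lemma finite_monic (F : Type*) [Field F] [Finite F] (d : ℕ) :
    {a : F[X] | a.Monic ∧ a.natDegree = d}.Finite := by
  have : Finite (degreeLT F (d + 1)) :=
    Finite.of_equiv _ (degreeLTEquiv F (d + 1)).toEquiv.symm
  refine (Set.toFinite (degreeLT F (d + 1) : Set F[X])).subset ?_
  rintro a ⟨-, ha⟩
  exact mem_degreeLT.2 (degree_le_natDegree.trans_lt (by rw [ha]; exact_mod_cast Nat.lt_succ_self d))

/-- `A⁺(d)`: the monic polynomials of degree `d`. -/
def monics (F : Type*) [Field F] [Finite F] (d : ℕ) : Finset F[X] := (finite_monic F d).toFinset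

section Series

variable {F : Type*} [Field F] [Finite F]

/-- The `1`-unit `⟨a⟩ = a / θ ^ deg a`. -/
def oneUnit (a : F[X]) : CInfty F := embA F a / theta F ^ a.natDegree

variable {p : ℕ} [Fact p.Prime]

/-- The `i`-th digit `y_i ∈ {0, …, p - 1}` of the `p`-adic expansion `y = ∑ y_i p ^ i`. -/
def padicDigit (y : ℤ_[p]) (i : ℕ) : ℕ := y.appr (i + 1) / p ^ i

/-- The binomial `∏_i (y_i choose j_i)`, where `y_i`, `j_i` are the `p`-adic digits of `y`
and `j`; the product is over the positions of the digits of `j`. -/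
def lucasChoose (y : ℤ_[p]) (j : ℕ) : ℕ :=
  ∏ i ∈ Finset.range (Nat.digits p j).length, (padicDigit y i).choose ((Nat.digits p j).getD i 0)

/-- `⟨a⟩ ^ y = ∑_{j ≥ 0} (y choose j) (⟨a⟩ - 1) ^ j` for `y ∈ ℤ_p`. -/
def oneUnitPow (a : F[X]) (y : ℤ_[p]) : CInfty F :=
  ∑' j : ℕ, (lucasChoose y j : CInfty F) * (oneUnit a - 1) ^ j

variable (F p) in
/-- The topological group `𝕊_∞ = ℂ_∞ˣ × ℤ_p`. -/
abbrev SInfty : Type _ := (CInfty F)ˣ × ℤ_[p]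

/-- `S_{d,s}(x,y)(t₁,…,t_s) = x ^ (-d) ∑_{a ∈ A⁺(d)} χ_{t₁}(a) ⋯ χ_{t_s}(a) ⟨a⟩ ^ y`. -/
def termS {s : ℕ} (d : ℕ) (t : Fin s → CInfty F) (z : SInfty F p) : CInfty F :=
  ((z.1 : CInfty F) ^ d)⁻¹ * ∑ a ∈ monics F d, (∏ i, chi F (t i) a) * oneUnitPow a z.2

/-- `L(χ_{t₁} ⋯ χ_{t_s}; x, y) = ∑_{d ≥ 0} S_{d,s}(x,y)(t₁,…,t_s)`. -/
def LSeries {s : ℕ} (t : Fin s → CInfty F) (z : SInfty F p) : CInfty F :=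
  ∑' d : ℕ, termS d t z

/-- The degree `d` part `∑_{a ∈ A⁺(d)} χ_{t₁}(a) ^ M₁ ⋯ χ_{t_s}(a) ^ M_s a ^ (-α)` of the series
`L(χ_{t₁} ^ M₁ ⋯ χ_{t_s} ^ M_s, α)`. -/
def termL {s : ℕ} (M : Fin s → ℕ) (α : ℕ) (d : ℕ) (t : Fin s → CInfty F) : CInfty F :=
  ∑ a ∈ monics F d, (∏ i, chi F (t i) a ^ M i) * (embA F a ^ α)⁻¹

/-- `L(χ_{t₁} ^ M₁ ⋯ χ_{t_s} ^ M_s, α) = ∑_{d ≥ 0} ∑_{a ∈ A⁺(d)} …`. -/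
def LValue {s : ℕ} (M : Fin s → ℕ) (α : ℕ) (t : Fin s → CInfty F) : CInfty F :=
  ∑' d : ℕ, termL M α d t

/-! ### Entire and continuous-analytic functions -/

/-- Rigid analytic entire functions `ℂ_∞ ^ n → ℂ_∞`: the sums of power series `∑ c_k t ^ k` with
`|c_k| R ^ |k| → 0` for every real `R ≥ 0`. -/
def IsEntire {n : ℕ} (f : (Fin n → CInfty F) → CInfty F) : Prop :=
  ∃ c : (Fin n →₀ ℕ) → CInfty F,
    (∀ R : ℝ, 0 ≤ R → Tendsto (fun k => ‖c k‖ * R ^ k.degree) cofinite (𝓝 0)) ∧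
    ∀ t, HasSum (fun k => c k * ∏ i, t i ^ k i) (f t)

/-- Continuous-analytic functions on `ℂ_∞ ^ s × 𝕊_∞` in the sense of Goss: continuous functions
`f (t, (x, y))` which, for each `y ∈ ℤ_p`, are given by an entire power series in `t₁, …, t_s` and
`x⁻¹`, and such that this entire function depends continuously on `y`, for the uniform convergence
on bounded sets of values of `(t, x⁻¹)`. -/
structure IsContinuousAnalytic {s : ℕ} (f : (Fin s → CInfty F) × SInfty F p → CInfty F) :
    Prop where
  continuous : Continuous f
  entire : ∀ y : ℤ_[p], ∃ g : (Fin (s + 1) → CInfty F) → CInfty F, IsEntire g ∧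
    ∀ (t : Fin s → CInfty F) (x : (CInfty F)ˣ),
      f (t, (x, y)) = g (Fin.cons (x : CInfty F)⁻¹ t)
  family : ∀ (y : ℤ_[p]) (R : ℝ),
    TendstoUniformlyOn
      (fun (y' : ℤ_[p]) (w : (Fin s → CInfty F) × (CInfty F)ˣ) => f (w.1, (w.2, y')))
      (fun w => f (w.1, (w.2, y))) (𝓝 y)
      {w | (∀ i, ‖w.1 i‖ ≤ R) ∧ ‖(w.2 : CInfty F)⁻¹‖ ≤ R}

end Series

end GossL

end

noncomputable section

namespace GossL

/-! ### Ultrametric estimates -/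

/-! Write `n < p ^ m` in base `p`. On monic polynomials of degree `d`, `⟨a⟩ ^ n` is a product of at
most `m(p - 1)` Frobenius twists of `a / θ ^ d`, each additive in `a`. A product of fewer than `d`
additive functions sums to zero over `A⁺(d)`: after expansion in the `d` free coefficients, every
term misses one of them, and summing over that one gives a factor `q = 0`
(`sum_monics_prod_eq_zero`). With `S` the number of factors `χ`, the degree `d` sum for the exponent
`n` thus vanishes once `S + m(p - 1) < d` (`weightSum_oneUnit_pow_eq_zero`).

For `y ∈ ℤ_p`, Lucas' theorem puts `⟨a⟩ ^ y` within `|θ| ^ (-p ^ m)` of `⟨a⟩ ^ n`, where `n` is `y`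
truncated modulo `p ^ m` (`norm_oneUnitPow_sub_le`). Taking `m` about `(d - S) / (p - 1)`, the
coefficients of the degree `d` polynomial decay doubly exponentially in `d`, uniformly in `y`, while
its degree grows only linearly. Such a series is entire (`isEntire_tsum_eval`). The uniformity in
`y` also gives joint continuity and continuity of the family. The values at `α` come from `y = -α`,
`x = θ ^ α`. -/

lemma norm_tsum_le_of_forall_le {E ι : Type*} [NormedAddCommGroup E] [IsUltrametricDist E]
    {f : ι → E} {b : ℝ} (hb : 0 ≤ b) (h : ∀ i, ‖f i‖ ≤ b) : ‖∑' i, f i‖ ≤ b := by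
  by_cases hf : Summable f
  · exact le_of_tendsto hf.hasSum.norm (Eventually.of_forall fun s =>
      IsUltrametricDist.norm_sum_le_of_forall_le_of_nonneg hb fun i _ => h i)
  · rwa [tsum_eq_zero_of_not_summable hf, norm_zero]

lemma norm_sub_le_max_norm {E : Type*} [NormedAddCommGroup E] [IsUltrametricDist E] (u v : E) :
    ‖u - v‖ ≤ max ‖u‖ ‖v‖ := by
  rw [sub_eq_add_neg, ← norm_neg v]
  exact IsUltrametricDist.norm_add_le_max _ _

lemma norm_tsum_sub_tsum_le {E ι : Type*} [NormedAddCommGroup E] [IsUltrametricDist E]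
    {f g : ι → E} {b : ℝ} (hb : 0 ≤ b) (hf : Summable f) (hg : Summable g)
    (h : ∀ i, ‖f i - g i‖ ≤ b) : ‖∑' i, f i - ∑' i, g i‖ ≤ b := by
  rw [← hf.tsum_sub hg]
  exact norm_tsum_le_of_forall_le hb h

/-! ### The absolute value of `ℂ_∞` on `θ` and on the constants -/

section FieldFacts

variable (F : Type*) [Field F] [Finite F]

lemma norm_embK (r : RatFunc F) :
    ‖embK F r‖ = ‖algebraMap (RatFunc F) (KInfty F) r‖ := by
  have h1 : ‖embK F r‖ = ‖algebraMap (KInfty F) (KInftyAlg F)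
      (algebraMap (RatFunc F) (KInfty F) r)‖ :=
    UniformSpace.Completion.norm_coe _
  rw [h1]
  exact spectralNorm_extends (K := KInfty F) (L := KInftyAlg F) _

lemma one_lt_norm_theta : 1 < ‖theta F‖ := by
  have h : theta F = embK F RatFunc.X := by
    simp [theta, embA, RatFunc.algebraMap_X]
  rw [h, norm_embK, Valued.toNormedField.one_lt_norm_iff, v_algebraMap]
  rw [RatFunc.inftyValuation.X, ← WithZero.exp_zero, WithZero.exp_lt_exp]
  exact zero_lt_one

lemma theta_ne_zero : theta F ≠ 0 := by
  have := one_lt_norm_theta F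
  rintro h
  rw [h, norm_zero] at this
  linarith

/-- The embedding of the constants `F` in `ℂ_∞`. -/
def embF : F →+* CInfty F := (embA F).comp C

lemma natCard_cast_eq_zero {R : Type*} [Semiring R] (φ : F →+* R) : (Nat.card F : R) = 0 := by
  have : Fintype F := Fintype.ofFinite F
  rw [← map_natCast φ, Nat.card_eq_fintype_card, FiniteField.cast_card_eq_zero, map_zero]

/-- Since `c ^ q = c`, the norm is fixed by the `q`-th power, so it cannot exceed `1`. -/
lemma norm_embF_le_one (c : F) : ‖embF F c‖ ≤ 1 := by
  have : Fintype F := Fintype.ofFinite F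
  have h : ‖embF F c‖ ^ Fintype.card F = ‖embF F c‖ := by
    rw [← norm_pow, ← map_pow, FiniteField.pow_card]
  by_contra! hc
  exact (lt_self_pow₀ hc Fintype.one_lt_card).ne' h

instance ultraCInfty : IsUltrametricDist (CInfty F) :=
  IsUltrametricDist.isUltrametricDist_of_forall_norm_natCast_le_one fun n => by
    simpa using norm_embF_le_one F n

instance charPCInfty (p : ℕ) [CharP F p] : CharP (CInfty F) p :=
  charP_of_injective_ringHom (embF F).injective p

lemma embA_eq_sum (a : F[X]) :
    embA F a = ∑ i ∈ Finset.range (a.natDegree + 1), embF F (a.coeff i) * theta F ^ i := by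
  conv_lhs => rw [a.as_sum_range_C_mul_X_pow]
  simp [embF, theta]

lemma inv_norm_theta_pos : 0 < ‖theta F‖⁻¹ := by
  have := one_lt_norm_theta F
  positivity

lemma inv_norm_theta_lt_one : ‖theta F‖⁻¹ < 1 := inv_lt_one_of_one_lt₀ (one_lt_norm_theta F)

end FieldFacts

/-- The leading term cancels the `1`, and each remaining term carries at least one factor `θ⁻¹`. -/
lemma norm_oneUnit_sub_one_le {F : Type*} [Field F] [Finite F] {a : F[X]} (ha : a.Monic) :
    ‖oneUnit a - 1‖ ≤ ‖theta F‖⁻¹ := by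
  have h0 := theta_ne_zero F
  have h : oneUnit a - 1
      = ∑ i ∈ Finset.range a.natDegree, embF F (a.coeff i) * (theta F ^ (a.natDegree - i))⁻¹ := by
    rw [oneUnit, embA_eq_sum, Finset.sum_range_succ, ha.coeff_natDegree, map_one, one_mul, add_div,
      div_self (pow_ne_zero _ h0), add_sub_cancel_right, Finset.sum_div]
    refine Finset.sum_congr rfl fun i hi => ?_
    have hi := Finset.mem_range.1 hi
    rw [mul_div_assoc]
    congr 1
    rw [div_eq_iff (pow_ne_zero _ h0), inv_mul_eq_div, eq_div_iff (pow_ne_zero _ h0), ← pow_add]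
    congr 1
    lia
  rw [h]
  refine IsUltrametricDist.norm_sum_le_of_forall_le_of_nonneg (inv_norm_theta_pos F).le
    fun i hi => ?_
  have hi := Finset.mem_range.1 hi
  rw [norm_mul, norm_inv, norm_pow, ← one_mul ‖theta F‖⁻¹]
  gcongr
  · exact norm_embF_le_one F _
  · exact le_self_pow₀ (one_lt_norm_theta F).le (by lia)

/-! ### The powers `⟨a⟩ ^ y` -/

section Powers

variable {p : ℕ} [hp : Fact p.Prime]

lemma appr_div_mod (y : ℤ_[p]) {i m : ℕ} (hi : i < m) :
    y.appr m / p ^ i % p = padicDigit y i := by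
  have h : y.appr m % p ^ (i + 1) = y.appr (i + 1) := by
    obtain ⟨c, hc⟩ := y.dvd_appr_sub_appr (i + 1) m hi
    have h2 := y.appr_mono (Nat.succ_le_of_lt hi)
    have h3 : y.appr m = y.appr (i + 1) + p ^ (i + 1) * c := by lia
    rw [h3, Nat.add_mul_mod_self_left, Nat.mod_eq_of_lt (y.appr_lt _)]
  rw [padicDigit, ← h, pow_succ, Nat.mod_mul_right_div_self]

/-- Padding `j` with zero digits only adds factors `choose _ 0 = 1`. -/
lemma lucasChoose_eq_prod (y : ℤ_[p]) {j m : ℕ} (hj : j < p ^ m) :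
    lucasChoose y j = ∏ i ∈ Finset.range m, (padicDigit y i).choose (j / p ^ i % p) := by
  have hlen : (Nat.digits p j).length ≤ m :=
    (Nat.digits_length_le_iff hp.out.one_lt j).2 hj
  have h2 : 2 ≤ p := hp.out.two_le
  rw [lucasChoose, ← Finset.prod_subset (Finset.range_mono hlen)]
  · exact Finset.prod_congr rfl fun i _ => by rw [Nat.getD_digits _ _ h2]
  · intro i _ hi
    rw [← Nat.getD_digits _ _ h2, List.getD_eq_default _ _ (by simpa using hi),
      Nat.choose_zero_right]

/-- Lucas' theorem: in characteristic `p` the digitwise product is an ordinary binomial coefficient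
of a truncation of `y`. -/
lemma lucasChoose_cast {R : Type*} [Ring R] [CharP R p] (y : ℤ_[p]) {j m : ℕ} (hj : j < p ^ m) :
    (lucasChoose y j : R) = ((y.appr m).choose j : R) := by
  rw [CharP.natCast_eq_natCast R p, lucasChoose_eq_prod y hj]
  refine (Choose.choose_modEq_prod_range_choose_nat (y.appr_lt m) hj |>.trans ?_).symm
  rw [Finset.prod_congr rfl fun i hi => by rw [appr_div_mod y (Finset.mem_range.1 hi)]]

/-- The first `p ^ m` terms are the binomial expansion of the power of `1 + h`; the tail starts at
`h ^ p ^ m`. -/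
lemma norm_tsum_lucasChoose_sub_le {E : Type*} [NormedField E] [IsUltrametricDist E]
    [CompleteSpace E] [CharP E p] (y : ℤ_[p]) {h : E} (hh : ‖h‖ < 1) (m : ℕ) :
    ‖∑' j, (lucasChoose y j : E) * h ^ j - (1 + h) ^ y.appr m‖ ≤ ‖h‖ ^ p ^ m := by
  have hle : ∀ j, ‖(lucasChoose y j : E) * h ^ j‖ ≤ ‖h‖ ^ j := fun j => by
    rw [norm_mul, norm_pow]
    exact mul_le_of_le_one_left (by positivity) (IsUltrametricDist.norm_natCast_le_one E _)
  have hs : Summable fun j => (lucasChoose y j : E) * h ^ j :=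
    .of_norm_bounded (summable_geometric_of_lt_one (norm_nonneg h) hh) hle
  have hfin : (1 + h) ^ y.appr m = ∑ j ∈ Finset.range (p ^ m), (lucasChoose y j : E) * h ^ j := by
    rw [add_comm, add_pow, Finset.sum_subset (Finset.range_mono (y.appr_lt m))]
    · refine Finset.sum_congr rfl fun j hj => ?_
      rw [lucasChoose_cast y (Finset.mem_range.1 hj), one_pow, mul_one, mul_comm]
    · intro j _ hj
      rw [Nat.choose_eq_zero_of_lt (by simpa using hj), Nat.cast_zero, mul_zero]
  rw [hfin, ← hs.sum_add_tsum_nat_add (p ^ m), add_sub_cancel_left]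
  refine norm_tsum_le_of_forall_le (by positivity) fun j => (hle _).trans ?_
  exact pow_le_pow_of_le_one (norm_nonneg h) hh.le (by lia)

variable {F : Type*} [Field F] [Finite F] [CharP F p] {a : F[X]}

lemma norm_oneUnitPow_sub_le (ha : a.Monic) (y : ℤ_[p]) (m : ℕ) :
    ‖oneUnitPow a y - oneUnit a ^ y.appr m‖ ≤ ‖theta F‖⁻¹ ^ p ^ m := by
  have h1 := norm_oneUnit_sub_one_le ha
  have h2 := norm_tsum_lucasChoose_sub_le y (h1.trans_lt (inv_norm_theta_lt_one F)) m
  rw [add_sub_cancel] at h2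
  exact h2.trans (pow_le_pow_left₀ (norm_nonneg _) h1 _)

lemma norm_oneUnit (ha : a.Monic) : ‖oneUnit a‖ = 1 := by
  have h1 := (norm_oneUnit_sub_one_le ha).trans_lt (inv_norm_theta_lt_one F)
  have := IsUltrametricDist.norm_add_eq_max_of_norm_ne_norm
    (x := oneUnit a - 1) (y := 1) (by rw [norm_one]; exact h1.ne)
  rw [sub_add_cancel, norm_one] at this
  rw [this, max_eq_right h1.le]

lemma norm_oneUnitPow_sub_oneUnitPow_le (ha : a.Monic) {y y' : ℤ_[p]} {m : ℕ}
    (h : y'.appr m = y.appr m) :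
    ‖oneUnitPow a y' - oneUnitPow a y‖ ≤ ‖theta F‖⁻¹ ^ p ^ m := by
  have h1 := norm_oneUnitPow_sub_le ha y m
  have h2 := norm_oneUnitPow_sub_le ha y' m
  rw [h] at h2
  rw [← dist_eq_norm] at h1 h2 ⊢
  exact (dist_triangle_max _ (oneUnit a ^ y.appr m) _).trans (max_le h2 (by rwa [dist_comm]))

lemma eventually_appr_eq (y : ℤ_[p]) (m : ℕ) : ∀ᶠ y' in 𝓝 y, y'.appr m = y.appr m := by
  have hpos : (0 : ℝ) < (p : ℝ) ^ (-m : ℤ) := zpow_pos (by exact_mod_cast hp.out.pos) _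
  filter_upwards [Metric.closedBall_mem_nhds y hpos] with y' hy'
  rw [Metric.mem_closedBall, dist_eq_norm, PadicInt.norm_le_pow_iff_mem_span_pow] at hy'
  have h : PadicInt.toZModPow m y' = PadicInt.toZModPow m y := by
    rw [← sub_eq_zero, ← map_sub, ← RingHom.mem_ker, PadicInt.ker_toZModPow]
    exact hy'
  have h2 : ((y'.appr m : ℕ) : ZMod (p ^ m)) = ((y.appr m : ℕ) : ZMod (p ^ m)) := h
  rw [ZMod.natCast_eq_natCast_iff] at h2
  exact h2.eq_of_lt_of_lt (y'.appr_lt m) (y.appr_lt m)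

lemma tendsto_inv_norm_theta_pow_pow (F : Type*) [Field F] [Finite F] :
    Tendsto (fun m : ℕ => ‖theta F‖⁻¹ ^ p ^ m) atTop (𝓝 0) :=
  (tendsto_pow_atTop_nhds_zero_of_lt_one (inv_norm_theta_pos F).le (inv_norm_theta_lt_one F)).comp
    (tendsto_pow_atTop_atTop_of_one_lt hp.out.one_lt)

lemma continuous_oneUnitPow (ha : a.Monic) : Continuous fun y : ℤ_[p] => oneUnitPow a y := by
  refine continuous_iff_continuousAt.2 fun y => Metric.tendsto_nhds.2 fun ε hε => ?_
  obtain ⟨m, hm⟩ := ((tendsto_inv_norm_theta_pow_pow (p := p) F).eventually_lt_const hε).exists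
  filter_upwards [eventually_appr_eq y m] with y' hy'
  rw [dist_eq_norm]
  exact (norm_oneUnitPow_sub_oneUnitPow_le ha hy').trans_lt hm

lemma oneUnitPow_neg_natCast (ha : a.Monic) (α : ℕ) :
    oneUnitPow a (-α : ℤ_[p]) = (oneUnit a ^ α)⁻¹ := by
  have hu := norm_oneUnit ha
  have hne : oneUnit a ≠ 0 := norm_ne_zero_iff.1 (by rw [hu]; exact one_ne_zero)
  refine eq_inv_of_mul_eq_one_left ?_
  rw [← sub_eq_zero, ← norm_le_zero_iff]
  refine ge_of_tendsto' (tendsto_inv_norm_theta_pow_pow (p := p) F) fun m => ?_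
  have h1 := norm_oneUnitPow_sub_le ha (-α : ℤ_[p]) m
  set n := (-α : ℤ_[p]).appr m with hn
  -- As `n` truncates `-α`, the power `⟨a⟩ ^ (n + α)` is a `p ^ m`-th power of a `1`-unit, hence
  -- close to `1` by Frobenius.
  have hdvd : p ^ m ∣ n + α := by
    have h : ((n : ℕ) : ZMod (p ^ m)) = PadicInt.toZModPow m (-α : ℤ_[p]) := rfl
    rw [map_neg, map_natCast] at h
    rw [← ZMod.natCast_eq_zero_iff, Nat.cast_add, h, neg_add_cancel]
  obtain ⟨k, hk⟩ := hdvd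
  have h2 : ‖oneUnit a ^ (n + α) - 1‖ ≤ ‖theta F‖⁻¹ ^ p ^ m := by
    have h3 : (oneUnit a ^ k - 1) ^ p ^ m = oneUnit a ^ (n + α) - 1 := by
      rw [sub_pow_char_pow, one_pow, ← pow_mul, mul_comm, hk]
    rw [← h3, norm_pow]
    refine pow_le_pow_left₀ (norm_nonneg _) ?_ _
    rw [← mul_geom_sum, norm_mul, ← mul_one ‖theta F‖⁻¹]
    refine mul_le_mul (norm_oneUnit_sub_one_le ha) ?_ (norm_nonneg _) (inv_norm_theta_pos F).le
    refine IsUltrametricDist.norm_sum_le_of_forall_le_of_nonneg zero_le_one fun i _ => ?_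
    rw [norm_pow, hu, one_pow]
  have h4 : oneUnitPow a (-α : ℤ_[p]) * oneUnit a ^ α - 1
      = (oneUnitPow a (-α : ℤ_[p]) - oneUnit a ^ n) * oneUnit a ^ α
        + (oneUnit a ^ (n + α) - 1) := by ring
  rw [h4]
  refine (IsUltrametricDist.norm_add_le_max _ _).trans (max_le ?_ h2)
  rwa [norm_mul, norm_pow, hu, one_pow, mul_one]

end Powers

/-! ### Vanishing of power sums over monic polynomials -/

section Vanishing

/-- `G` is constant along the `i`-th coordinate, so each fibre contributes a multiple of the
cardinality of `κ`. -/
lemma sum_eq_zero_of_update_eq {ι κ R : Type*} [Fintype ι] [DecidableEq ι] [Fintype κ] [Zero κ]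
    [Semiring R] (hκ : (Fintype.card κ : R) = 0) (G : (ι → κ) → R) (i : ι)
    (h : ∀ c v, G (Function.update c i v) = G c) : ∑ c, G c = 0 := by
  rw [← (Equiv.funSplitAt i κ).symm.sum_comp, Fintype.sum_prod_type_right]
  refine Finset.sum_eq_zero fun r _ => ?_
  have hv : ∀ v, G ((Equiv.funSplitAt i κ).symm (v, r)) = G ((Equiv.funSplitAt i κ).symm (0, r)) :=
    fun v => by
      rw [← h ((Equiv.funSplitAt i κ).symm (0, r)) v]
      congr 1
      ext j
      by_cases hj : j = i
      · subst hj; simp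
      · simp [hj]
  rw [Finset.sum_congr rfl fun v _ => hv v, Finset.sum_const, Finset.card_univ, nsmul_eq_mul, hκ,
    zero_mul]

variable {F : Type*} [Field F] [Finite F]

lemma mem_monics {d : ℕ} {a : F[X]} : a ∈ monics F d ↔ a.Monic ∧ a.natDegree = d := by
  simp [monics]

lemma sum_monics_eq_sum_coeff [Fintype F] {R : Type*} [AddCommMonoid R] (d : ℕ) (G : F[X] → R) :
    ∑ a ∈ monics F d, G a = ∑ c : Fin d → F, G (X ^ d + ∑ i, C (c i) * X ^ (i : ℕ)) := by
  have hc : ∀ (c : Fin d → F) (i : Fin d),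
      (∑ i, C (c i) * X ^ (i : ℕ) : F[X]).coeff i = c i := fun c i => by
    simp only [finsetSum_coeff, coeff_C_mul, coeff_X_pow, Fin.val_inj]
    simp
  refine Finset.sum_nbij' (fun a i => a.coeff i) (fun c => X ^ d + ∑ i, C (c i) * X ^ (i : ℕ))
    (fun _ _ => Finset.mem_univ _) (fun c _ => mem_monics.2 ?_) (fun a ha => ?_) (fun c _ => ?_)
    (fun a ha => ?_)
  · exact ⟨monic_X_pow_add (degree_sum_fin_lt c), natDegree_eq_of_degree_eq_some
      ((degree_add_eq_left_of_degree_lt (by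
        rw [degree_X_pow]; exact degree_sum_fin_lt c)).trans (degree_X_pow d))⟩
  · obtain ⟨hm, rfl⟩ := mem_monics.1 ha
    conv_rhs => rw [hm.as_sum]
    rw [Finset.sum_range]
  · ext i
    rw [coeff_add, hc, coeff_X_pow, if_neg i.2.ne, zero_add]
  · obtain ⟨hm, rfl⟩ := mem_monics.1 ha
    conv_lhs => rw [hm.as_sum]
    rw [Finset.sum_range]

/-- A product of fewer than `d` additive functions sums to zero over the monic polynomials of
degree `d`. -/
lemma sum_monics_prod_eq_zero {R : Type*} [CommRing R] (hR : (Nat.card F : R) = 0) {J : Type*}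
    [Fintype J] (l : J → F[X] →+ R) {d : ℕ} (hd : Fintype.card J < d) :
    ∑ a ∈ monics F d, ∏ j, l j a = 0 := by
  classical
  have : Fintype F := Fintype.ofFinite F
  -- `none` stands for the leading term `X ^ d`, `some i` for the term of the free coefficient `c
  -- i`.
  let f : J → Option (Fin d) → (Fin d → F) → R := fun j o c =>
    o.elim (l j (X ^ d)) fun i => l j (C (c i) * X ^ (i : ℕ))
  have hf : ∀ (c : Fin d → F) (j : J),
      l j (X ^ d + ∑ i, C (c i) * X ^ (i : ℕ)) = ∑ o, f j o c := fun c j => by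
    simp [f, Fintype.sum_option]
  rw [sum_monics_eq_sum_coeff]
  simp only [hf, Finset.prod_univ_sum, Fintype.piFinset_univ]
  rw [Finset.sum_comm]
  refine Finset.sum_eq_zero fun g _ => ?_
  -- Pigeonhole: fewer than `d` factors cannot involve all `d` free coefficients.
  obtain ⟨i, hi⟩ : ∃ i : Fin d, ∀ j, g j ≠ some i := by
    by_contra! h
    choose e he using h
    have hinj : Function.Injective e := fun i i' hii => by
      have h1 := he i
      rw [hii, he i'] at h1
      exact (Option.some_injective _ h1).symm
    have := Fintype.card_le_of_injective e hinj
    rw [Fintype.card_fin] at this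
    lia
  refine sum_eq_zero_of_update_eq (by rwa [Nat.card_eq_fintype_card] at hR) _ i fun c v => ?_
  refine Finset.prod_congr rfl fun j _ => ?_
  have hj := hi j
  simp only [f]
  cases hg : g j with
  | none => rfl
  | some k =>
    rw [hg] at hj
    have hk : k ≠ i := fun h => hj (congrArg some h)
    simp [Function.update_of_ne hk]

end Vanishing

lemma exists_digits {p : ℕ} (hp : 0 < p) (m : ℕ) : ∀ n < p ^ m,
    ∃ e : Fin m → ℕ, (∀ l, e l ≤ p - 1) ∧ n = ∑ l : Fin m, p ^ (l : ℕ) * e l := by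
  induction m with
  | zero => exact fun n hn => ⟨fun _ => 0, fun l => l.elim0, by simpa using hn⟩
  | succ m ih =>
    intro n hn
    obtain ⟨e, he, hne⟩ := ih (n / p) (Nat.div_lt_of_lt_mul (by rwa [← pow_succ']))
    refine ⟨Fin.cons (n % p) e, Fin.cases (Nat.le_sub_one_of_lt (Nat.mod_lt n hp)) he, ?_⟩
    rw [Fin.sum_univ_succ]
    simp only [Fin.cons_zero, Fin.cons_succ, Fin.val_zero, Fin.val_succ, pow_zero, one_mul,
      pow_succ', mul_assoc]
    rw [← Finset.mul_sum, ← hne, Nat.mod_add_div]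

/-! ### The polynomials in `t₁, …, t_s` given by a fixed degree -/

section WeightSum

variable {F : Type*} [Field F] [Finite F] {s : ℕ}

/-- `∏ i, a(T_i) ^ M_i` as a polynomial in `T₁, …, T_s` with coefficients in `F`. -/
def weight (M : Fin s → ℕ) (a : F[X]) : MvPolynomial (Fin s) F :=
  ∏ i, aeval (MvPolynomial.X i : MvPolynomial (Fin s) F) a ^ M i

/-- `∑_{a ∈ A⁺(d)} e(a) ∏ i, a(T_i) ^ M_i` as a polynomial in `T₁, …, T_s`. -/
def weightSum (M : Fin s → ℕ) (d : ℕ) (e : F[X] → CInfty F) : MvPolynomial (Fin s) (CInfty F) :=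
  ∑ a ∈ monics F d, MvPolynomial.C (e a) * MvPolynomial.map (embF F) (weight M a)

lemma eval_weight (M : Fin s → ℕ) (a : F[X]) (t : Fin s → CInfty F) :
    MvPolynomial.eval t (MvPolynomial.map (embF F) (weight M a)) = ∏ i, chi F (t i) a ^ M i := by
  simp only [weight, map_prod, map_pow]
  refine Finset.prod_congr rfl fun i _ => ?_
  congr 1
  rw [aeval_def, hom_eval₂, hom_eval₂]
  simp only [MvPolynomial.map_X, MvPolynomial.eval_X, chi, coe_eval₂RingHom]
  congr 1
  ext c
  simp [embF, MvPolynomial.algebraMap_eq]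

lemma eval_weightSum (M : Fin s → ℕ) (d : ℕ) (e : F[X] → CInfty F) (t : Fin s → CInfty F) :
    MvPolynomial.eval t (weightSum M d e)
      = ∑ a ∈ monics F d, (∏ i, chi F (t i) a ^ M i) * e a := by
  simp only [weightSum, map_sum, map_mul, eval_weight, MvPolynomial.eval_C, mul_comm]

lemma weightSum_sub (M : Fin s → ℕ) (d : ℕ) (e e' : F[X] → CInfty F) :
    weightSum M d (fun a => e a - e' a) = weightSum M d e - weightSum M d e' := by
  simp only [weightSum, map_sub, sub_mul, Finset.sum_sub_distrib]

lemma norm_coeff_weightSum_le (M : Fin s → ℕ) {d : ℕ} {e : F[X] → CInfty F} {b : ℝ} (hb : 0 ≤ b)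
    (he : ∀ a ∈ monics F d, ‖e a‖ ≤ b) (k : Fin s →₀ ℕ) : ‖(weightSum M d e).coeff k‖ ≤ b := by
  rw [weightSum, MvPolynomial.coeff_sum]
  refine IsUltrametricDist.norm_sum_le_of_forall_le_of_nonneg hb fun a ha => ?_
  rw [MvPolynomial.coeff_C_mul, MvPolynomial.coeff_map, norm_mul, ← mul_one b]
  exact mul_le_mul (he a ha) (norm_embF_le_one F _) (norm_nonneg _) hb

lemma totalDegree_weightSum_le (M : Fin s → ℕ) (d : ℕ) (e : F[X] → CInfty F) :
    (weightSum M d e).totalDegree ≤ (∑ i, M i) * d := by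
  refine MvPolynomial.totalDegree_finsetSum_le fun a ha => ?_
  refine (MvPolynomial.totalDegree_mul _ _).trans ?_
  rw [MvPolynomial.totalDegree_C, zero_add]
  refine (Finset.sup_mono (MvPolynomial.support_map_subset _ _)).trans ?_
  change (weight M a).totalDegree ≤ _
  refine (MvPolynomial.totalDegree_finsetProd _ _).trans ?_
  rw [Finset.sum_mul]
  refine Finset.sum_le_sum fun i _ => (MvPolynomial.totalDegree_pow _ _).trans ?_
  refine Nat.mul_le_mul_left _ ?_
  rw [aeval_eq_sum_range]
  refine MvPolynomial.totalDegree_finsetSum_le fun j hj => ?_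
  refine (MvPolynomial.totalDegree_smul_le _ _).trans ?_
  rw [MvPolynomial.totalDegree_X_pow, ← (mem_monics.1 ha).2]
  exact Nat.le_of_lt_succ (Finset.mem_range.1 hj)

variable {p : ℕ} [hp : Fact p.Prime] [CharP F p]

lemma weightSum_oneUnit_pow_eq_zero (M : Fin s → ℕ) {d m n : ℕ} (hn : n < p ^ m)
    (hd : (∑ i, M i) + m * (p - 1) < d) : weightSum (F := F) M d (fun a => oneUnit a ^ n) = 0 := by
  obtain ⟨e, he, rfl⟩ := exists_digits hp.out.pos m n hn
  -- One index per linear factor: `M i` copies of evaluation at `T_i`, and `e l` copies of the `p ^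
  -- l`-Frobenius of `a / θ ^ d`.
  let J := (Σ i : Fin s, Fin (M i)) ⊕ (Σ l : Fin m, Fin (e l))
  let R := MvPolynomial (Fin s) (CInfty F)
  let l : J → F[X] →+ R := Sum.elim
    (fun i => ((MvPolynomial.map (embF F)).comp (aeval
      (MvPolynomial.X i.1 : MvPolynomial (Fin s) F)).toRingHom).toAddMonoidHom)
    (fun i => ((MvPolynomial.C.comp (iterateFrobenius (CInfty F) p i.1)).toAddMonoidHom.comp
      ((AddMonoidHom.mulRight (theta F ^ d)⁻¹).comp (embA F).toAddMonoidHom)))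
  have hcard : Fintype.card J < d := by
    refine lt_of_le_of_lt ?_ hd
    simp only [J, Fintype.card_sum, Fintype.card_sigma, Fintype.card_fin]
    gcongr
    exact (Finset.sum_le_sum fun i _ => he i).trans (by simp)
  rw [weightSum, ← sum_monics_prod_eq_zero (natCard_cast_eq_zero F
    ((MvPolynomial.C : CInfty F →+* R).comp (embF F))) l hcard]
  refine Finset.sum_congr rfl fun a ha => ?_
  obtain ⟨-, rfl⟩ := mem_monics.1 ha
  rw [mul_comm, Fintype.prod_sum_type, Fintype.prod_sigma, Fintype.prod_sigma]
  congr 1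
  · simp [l, weight]
  · simp [l, ← Finset.prod_pow_eq_pow_sum, pow_mul, iterateFrobenius_def, oneUnit, div_eq_mul_inv]

variable (F p) in
/-- A bound, for the degree `d`, of the coefficients of the power series in `t₁, …, t_s`. -/
def decay (S d : ℕ) : ℝ := ‖theta F‖ * ‖theta F‖⁻¹ ^ p ^ ((d - S - 1) / (p - 1))

omit hp [CharP F p] in
lemma decay_nonneg (S d : ℕ) : 0 ≤ decay F p S d := by
  unfold decay; positivity

lemma norm_oneUnitPow_le_one {a : F[X]} (ha : a.Monic) (y : ℤ_[p]) : ‖oneUnitPow a y‖ ≤ 1 := by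
  have h := norm_oneUnitPow_sub_le ha y 0
  rw [pow_zero, pow_one] at h
  rw [← sub_add_cancel (oneUnitPow a y) (oneUnit a ^ y.appr 0)]
  refine (IsUltrametricDist.norm_add_le_max _ _).trans
    (max_le (h.trans (inv_norm_theta_lt_one F).le) ?_)
  rw [norm_pow, norm_oneUnit ha, one_pow]

/-- The sum for the truncation of `y` vanishes, so only the truncation error remains. For `d > ∑ i,
M i`, `m` is the largest integer allowed by the vanishing lemma. -/
lemma norm_coeff_weightSum_oneUnitPow_le (M : Fin s → ℕ) (d : ℕ) (y : ℤ_[p]) (k : Fin s →₀ ℕ) :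
    ‖(weightSum (F := F) M d fun a => oneUnitPow a y).coeff k‖ ≤ decay F p (∑ i, M i) d := by
  have h1 := one_lt_norm_theta F
  unfold decay
  set m := (d - (∑ i, M i) - 1) / (p - 1) with hm
  by_cases hd : ∑ i, M i < d
  · have h2 : m * (p - 1) ≤ d - (∑ i, M i) - 1 := Nat.div_mul_le_self _ _
    have h3 := weightSum_oneUnit_pow_eq_zero (F := F) M (y.appr_lt m) (d := d) (by lia)
    rw [← sub_zero (weightSum M d _), ← h3, ← weightSum_sub]
    refine (norm_coeff_weightSum_le M (by positivity) (fun a ha =>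
      norm_oneUnitPow_sub_le (mem_monics.1 ha).1 y m) k).trans ?_
    exact le_mul_of_one_le_left (by positivity) h1.le
  -- For small `d` only the trivial bound `1` is available; the factor `‖theta F‖` in `decay` makes
  -- it equal `1` at `m = 0`.
  · have h2 : m = 0 := by rw [hm, show d - (∑ i, M i) - 1 = 0 by lia, Nat.zero_div]
    rw [h2, pow_zero, pow_one, mul_inv_cancel₀ (by positivity)]
    exact norm_coeff_weightSum_le M zero_le_one (fun a ha =>
      norm_oneUnitPow_le_one (mem_monics.1 ha).1 y) k

omit [CharP F p] in
lemma tendsto_decay_mul_pow (S : ℕ) {R : ℝ} (hR : 1 ≤ R) :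
    Tendsto (fun d : ℕ => decay F p S d * R ^ d) atTop (𝓝 0) := by
  have h2 := hp.out.two_le
  have hr0 := inv_norm_theta_pos F
  -- With `R ^ (p - 1) < p ^ k`, `R ^ d` is at most a constant times the `k`-th power of `N = p ^
  -- m`, which is beaten by `‖theta F‖⁻¹ ^ N`.
  obtain ⟨k, hk⟩ := pow_unbounded_of_one_lt (R ^ (p - 1)) (by exact_mod_cast hp.out.one_lt :
    (1 : ℝ) < p)
  have hm : Tendsto (fun d : ℕ => p ^ ((d - S - 1) / (p - 1))) atTop atTop := by
    refine (tendsto_pow_atTop_atTop_of_one_lt hp.out.one_lt).comp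
      ((Nat.tendsto_div_const_atTop (by lia)).comp ?_)
    exact (tendsto_sub_atTop_nat 1).comp (tendsto_sub_atTop_nat S)
  have h := ((tendsto_pow_const_mul_const_pow_of_abs_lt_one k (r := ‖theta F‖⁻¹) (by
    rw [abs_of_pos hr0]; exact inv_norm_theta_lt_one F)).comp hm).const_mul
    (‖theta F‖ * R ^ (S + p))
  rw [mul_zero] at h
  refine squeeze_zero (fun d => mul_nonneg (decay_nonneg S d) (by positivity)) (fun d => ?_) h
  simp only [decay, Function.comp_apply, Nat.cast_pow]
  set m := (d - S - 1) / (p - 1) with hmd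
  have hd : d ≤ (S + p) + (p - 1) * m := by
    have := Nat.lt_mul_div_succ (d - S - 1) (show 0 < p - 1 by lia)
    rw [← hmd, mul_add, mul_one] at this
    lia
  have h3 : R ^ d ≤ R ^ (S + p) * ((p : ℝ) ^ m) ^ k := by
    refine (pow_le_pow_right₀ hR hd).trans ?_
    rw [pow_add, pow_mul, ← pow_mul (p : ℝ), mul_comm m, pow_mul (p : ℝ)]
    gcongr
  calc ‖theta F‖ * ‖theta F‖⁻¹ ^ p ^ m * R ^ d
      ≤ ‖theta F‖ * ‖theta F‖⁻¹ ^ p ^ m * (R ^ (S + p) * ((p : ℝ) ^ m) ^ k) := by gcongr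
    _ = _ := by ring

end WeightSum

/-! ### Entire functions as sums of polynomials -/

section Entire

variable {E : Type*} [NormedField E] [IsUltrametricDist E] {n : ℕ}

omit [IsUltrametricDist E] in
lemma norm_coeff_mul_prod_le {P : MvPolynomial (Fin n) E} {e : ℕ} {b R : ℝ}
    (he : P.totalDegree ≤ e) (hb : 0 ≤ b) (k : Fin n →₀ ℕ) (hk : ‖P.coeff k‖ ≤ b) (hR : 1 ≤ R)
    {t : Fin n → E} (ht : ∀ i, ‖t i‖ ≤ R) : ‖P.coeff k * ∏ i, t i ^ k i‖ ≤ b * R ^ e := by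
  have hR0 := zero_le_one.trans hR
  by_cases h : k ∈ P.support
  · have hdeg : ∑ i, k i ≤ e := by
      rw [← Finsupp.sum_fintype k (fun _ j => j) fun _ => rfl]
      exact (MvPolynomial.le_totalDegree h).trans he
    rw [norm_mul, norm_prod]
    refine mul_le_mul hk ?_ (by positivity) hb
    refine le_trans ?_ (pow_le_pow_right₀ hR hdeg)
    rw [← Finset.prod_pow_eq_pow_sum]
    refine Finset.prod_le_prod (fun i _ => norm_nonneg _) fun i _ => ?_
    rw [norm_pow]
    exact pow_le_pow_left₀ (norm_nonneg _) (ht i) _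
  · rw [MvPolynomial.notMem_support_iff.1 h, zero_mul, norm_zero]
    positivity

lemma norm_eval_le {P : MvPolynomial (Fin n) E} {e : ℕ} {b R : ℝ}
    (he : P.totalDegree ≤ e) (hb : 0 ≤ b) (hP : ∀ k, ‖P.coeff k‖ ≤ b) (hR : 1 ≤ R)
    {t : Fin n → E} (ht : ∀ i, ‖t i‖ ≤ R) : ‖MvPolynomial.eval t P‖ ≤ b * R ^ e := by
  rw [MvPolynomial.eval_eq']
  exact IsUltrametricDist.norm_sum_le_of_forall_le_of_nonneg (by positivity) fun k _ =>
    norm_coeff_mul_prod_le he hb k (hP k) hR ht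

/-- The real sequence `B` decays faster than every geometric sequence. -/
def IsRapidlyDecaying (B : ℕ → ℝ) : Prop :=
  (∀ d, 0 ≤ B d) ∧ ∀ R : ℝ, 1 ≤ R → Tendsto (fun d => B d * R ^ d) atTop (𝓝 0)

lemma IsRapidlyDecaying.summable {B : ℕ → ℝ} (hB : IsRapidlyDecaying B) {R : ℝ} (hR : 1 ≤ R) :
    Summable fun d => B d * R ^ d := by
  refine .of_norm_bounded_eventually_nat (g := fun d => (1 / 2 : ℝ) ^ d)
    (summable_geometric_of_lt_one (by norm_num) (by norm_num)) ?_
  filter_upwards [(hB.2 (2 * R) (by linarith)).eventually_le_const zero_lt_one] with d hd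
  rw [Real.norm_of_nonneg (mul_nonneg (hB.1 d) (by positivity)), one_div, inv_pow,
    ← one_div, le_div_iff₀ (by positivity)]
  calc _ = B d * (2 * R) ^ d := by ring
    _ ≤ 1 := hd

/-- In a complete ultrametric field, tending to zero suffices. Large `d` give small terms by decay,
and each smaller `d` has finite support. This double summability permits regrouping by monomials. -/
lemma summable_coeff_mul_prod [CompleteSpace E] {Q : ℕ → MvPolynomial (Fin n) E} {D : ℕ}
    {B : ℕ → ℝ}
    (hD : ∀ d, (Q d).totalDegree ≤ D * d) (hQ : ∀ d k, ‖(Q d).coeff k‖ ≤ B d)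
    (hB : IsRapidlyDecaying B) (t : Fin n → E) :
    Summable fun x : ℕ × (Fin n →₀ ℕ) => (Q x.1).coeff x.2 * ∏ i, t i ^ x.2 i := by
  obtain ⟨R, hR, ht⟩ : ∃ R : ℝ, 1 ≤ R ∧ ∀ i, ‖t i‖ ≤ R :=
    ⟨max 1 ‖t‖, le_max_left _ _, fun i => (norm_le_pi_norm t i).trans (le_max_right _ _)⟩
  refine NonarchimedeanAddGroup.summable_of_tendsto_cofinite_zero
    (Metric.tendsto_nhds.2 fun ε hε => ?_)
  obtain ⟨N, hN⟩ := eventually_atTop.1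
    ((hB.2 (R ^ D) (one_le_pow₀ hR)).eventually_lt_const hε)
  classical
  refine eventually_cofinite.2 (Set.Finite.subset (Finset.finite_toSet
    ((Finset.range N).biUnion fun d => (Q d).support.image (Prod.mk d))) ?_)
  rintro ⟨d, k⟩ hx
  rw [Set.mem_ofPred_eq, dist_zero_right, not_lt] at hx
  simp only [Finset.coe_biUnion, Set.mem_iUnion, Finset.mem_coe, Finset.mem_image, Finset.mem_range]
  refine ⟨d, ?_, k, ?_, rfl⟩
  · by_contra! hd
    refine absurd (hN d hd) (not_lt.2 (hx.trans ?_))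
    rw [← pow_mul]
    exact norm_coeff_mul_prod_le (hD d) (hB.1 d) k (hQ d k) hR ht
  · by_contra hk
    rw [MvPolynomial.notMem_support_iff.1 hk, zero_mul, norm_zero] at hx
    exact hε.not_ge hx

lemma hasSum_tsum_of_fiberwise {ι κ E : Type*} [NormedAddCommGroup E] {f : ι × κ → E} {g : ι → E}
    {h : κ → E} (hf : Summable f) (hg : ∀ i, HasSum (fun k => f (i, k)) (g i))
    (hh : ∀ k, HasSum (fun i => f (i, k)) (h k)) : HasSum h (∑' i, g i) := by
  rw [(hf.hasSum.prod_fiberwise hg).tsum_eq]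
  exact ((Equiv.prodComm κ ι).hasSum_iff.2 hf.hasSum).prod_fiberwise hh

lemma hasSum_tsum_coeff [CompleteSpace E] {Q : ℕ → MvPolynomial (Fin n) E} {D : ℕ} {B : ℕ → ℝ}
    (hD : ∀ d, (Q d).totalDegree ≤ D * d) (hQ : ∀ d k, ‖(Q d).coeff k‖ ≤ B d)
    (hB : IsRapidlyDecaying B) (t : Fin n → E) :
    Summable (fun d => MvPolynomial.eval t (Q d)) ∧
      HasSum (fun k => (∑' d, (Q d).coeff k) * ∏ i, t i ^ k i)
        (∑' d, MvPolynomial.eval t (Q d)) := by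
  have hc : ∀ k, Summable fun d => (Q d).coeff k := fun k => by
    have h := hB.summable le_rfl
    simp only [one_pow, mul_one] at h
    exact .of_norm_bounded h fun d => hQ d k
  have hfib : ∀ d, HasSum (fun k => (Q d).coeff k * ∏ i, t i ^ k i)
      (MvPolynomial.eval t (Q d)) := fun d => by
    rw [MvPolynomial.eval_eq']
    exact hasSum_sum_of_ne_finset_zero fun k hk => by
      rw [MvPolynomial.notMem_support_iff.1 hk, zero_mul]
  have hs := summable_coeff_mul_prod hD hQ hB t
  exact ⟨(hs.hasSum.prod_fiberwise hfib).summable,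
    hasSum_tsum_of_fiberwise hs hfib fun k => (hc k).hasSum.mul_right _⟩

/-- A series of polynomials with linearly growing degrees and rapidly decaying coefficients
converges to an entire function. -/
lemma isEntire_tsum_eval {F : Type*} [Field F] [Finite F]
    {Q : ℕ → MvPolynomial (Fin n) (CInfty F)} {D : ℕ} {B : ℕ → ℝ}
    (hD : ∀ d, (Q d).totalDegree ≤ D * d) (hQ : ∀ d k, ‖(Q d).coeff k‖ ≤ B d)
    (hB : IsRapidlyDecaying B) :
    (∀ t, Summable fun d => MvPolynomial.eval t (Q d)) ∧
      IsEntire fun t => ∑' d, MvPolynomial.eval t (Q d) := by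
  have h2 := hasSum_tsum_coeff hD hQ hB
  refine ⟨fun t => (h2 t).1, fun k => ∑' d, (Q d).coeff k, fun R hR => ?_, fun t => (h2 t).2⟩
  -- Convergence at the single point `(θ ^ j, …, θ ^ j)` with `|θ| ^ j > R` already forces the
  -- coefficient condition for `R`.
  obtain ⟨j, hj⟩ := pow_unbounded_of_one_lt R (one_lt_norm_theta F)
  have h := (h2 fun _ => theta F ^ j).2.summable.tendsto_cofinite_zero.norm
  rw [norm_zero] at h
  refine squeeze_zero (fun k => by positivity) (fun k => ?_) h
  rw [norm_mul, Finset.prod_pow_eq_pow_sum, norm_pow, norm_pow, ← Finsupp.degree_eq_sum]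
  gcongr

end Entire

section Main

variable {F : Type*} [Field F] [Finite F] {p : ℕ} [hp : Fact p.Prime] [CharP F p] {s : ℕ}

omit [CharP F p] in
lemma isRapidlyDecaying_decay (S : ℕ) : IsRapidlyDecaying (decay F p S) :=
  ⟨decay_nonneg S, fun _ hR => tendsto_decay_mul_pow S hR⟩

/-! ### The values `L(χ_{t₁} ^ M₁ ⋯ χ_{t_s} ^ M_s, α)` -/

/-- On `A⁺(d)`, `a ^ (-α) = θ ^ (-dα) ⟨a⟩ ^ (-α)`; the scalar has norm at most `1` and does not
spoil the decay. -/
lemma termL_eq_eval (M : Fin s → ℕ) (α d : ℕ) (t : Fin s → CInfty F) :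
    termL M α d t = MvPolynomial.eval t (MvPolynomial.C (theta F ^ (d * α))⁻¹ *
      weightSum M d fun a => oneUnitPow a (-α : ℤ_[p])) := by
  rw [map_mul, MvPolynomial.eval_C, eval_weightSum, termL, Finset.mul_sum]
  refine Finset.sum_congr rfl fun a ha => ?_
  obtain ⟨hm, rfl⟩ := mem_monics.1 ha
  rw [oneUnitPow_neg_natCast hm, oneUnit, div_pow, inv_div, pow_mul]
  have := pow_ne_zero α (pow_ne_zero a.natDegree (theta_ne_zero F))
  field_simp

lemma summable_termL_and_isEntire_LValue (p : ℕ) [Fact p.Prime] [CharP F p]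
    (M : Fin s → ℕ) (α : ℕ) :
    (∀ t : Fin s → CInfty F, Summable fun d => termL M α d t) ∧
      IsEntire fun t : Fin s → CInfty F => LValue M α t := by
  simp only [LValue, termL_eq_eval (p := p)]
  refine isEntire_tsum_eval (D := ∑ i, M i) (B := decay F p (∑ i, M i)) (fun d => ?_)
    (fun d k => ?_) (isRapidlyDecaying_decay _)
  · refine (MvPolynomial.totalDegree_mul _ _).trans ?_
    rw [MvPolynomial.totalDegree_C, zero_add]
    exact totalDegree_weightSum_le M d _
  · rw [MvPolynomial.coeff_C_mul, norm_mul, norm_inv, norm_pow]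
    refine le_trans (mul_le_of_le_one_left (norm_nonneg _) ?_)
      (norm_coeff_weightSum_oneUnitPow_le M d _ k)
    exact inv_le_one_of_one_le₀ (one_le_pow₀ (one_lt_norm_theta F).le)

/-! ### The series `L(χ_{t₁} ⋯ χ_{t_s}; x, y)` -/

/-- `X₀ ^ d ∑_{a ∈ A⁺(d)} e(a) ∏ i, a(X_{i + 1})`. -/
def termPoly (s d : ℕ) (e : F[X] → CInfty F) : MvPolynomial (Fin (s + 1)) (CInfty F) :=
  MvPolynomial.monomial (Finsupp.single 0 d) 1 *
    MvPolynomial.rename Fin.succ (weightSum (fun _ : Fin s => 1) d e)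

lemma termPoly_sub (d : ℕ) (e e' : F[X] → CInfty F) :
    termPoly s d (fun a => e a - e' a) = termPoly s d e - termPoly s d e' := by
  rw [termPoly, weightSum_sub, map_sub, mul_sub]; rfl

/-- Renaming variables injectively and multiplying by a monomial only relocate coefficients. -/
lemma norm_coeff_termPoly_le {d : ℕ} {e : F[X] → CInfty F} {b : ℝ} (hb : 0 ≤ b)
    (h : ∀ k, ‖(weightSum (fun _ : Fin s => 1) d e).coeff k‖ ≤ b) (k : Fin (s + 1) →₀ ℕ) :
    ‖(termPoly s d e).coeff k‖ ≤ b := by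
  rw [termPoly, MvPolynomial.coeff_monomial_mul', one_mul]
  split_ifs
  · by_cases hk : ∃ u, u.mapDomain Fin.succ = k - Finsupp.single 0 d ∧
        (weightSum (fun _ : Fin s => 1) d e).coeff u ≠ 0
    · obtain ⟨u, hu, -⟩ := hk
      rw [← hu, MvPolynomial.coeff_rename_mapDomain _ (Fin.succ_injective s)]
      exact h u
    · push Not at hk
      rw [MvPolynomial.coeff_rename_eq_zero _ _ _ hk, norm_zero]
      exact hb
  · rwa [norm_zero]

lemma totalDegree_termPoly_le (d : ℕ) (e : F[X] → CInfty F) :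
    (termPoly s d e).totalDegree ≤ (s + 1) * d := by
  refine (MvPolynomial.totalDegree_mul _ _).trans ?_
  have h1 := MvPolynomial.totalDegree_monomial_le (Finsupp.single (0 : Fin (s + 1)) d)
    (1 : CInfty F)
  have h2 := MvPolynomial.totalDegree_rename_le Fin.succ (weightSum (fun _ : Fin s => 1) d e)
  have h3 := totalDegree_weightSum_le (fun _ : Fin s => 1) d e
  simp only [Finset.sum_const, Finset.card_univ, Fintype.card_fin, smul_eq_mul, mul_one] at h3
  rw [Finsupp.sum_single_index rfl, id_eq] at h1
  rw [add_mul, one_mul, add_comm (s * d)]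
  exact add_le_add h1 (h2.trans h3)

omit [CharP F p] in
lemma termS_eq_eval (d : ℕ) (t : Fin s → CInfty F) (z : SInfty F p) :
    termS d t z = MvPolynomial.eval (Fin.cons (z.1 : CInfty F)⁻¹ t)
      (termPoly s d fun a => oneUnitPow a z.2) := by
  rw [termPoly, map_mul, MvPolynomial.eval_monomial, MvPolynomial.eval_rename, one_mul,
    Finsupp.prod_single_index (h := fun i e =>
      (Fin.cons (z.1 : CInfty F)⁻¹ t : Fin (s + 1) → CInfty F) i ^ e) (pow_zero _), Fin.cons_zero,
    inv_pow, termS]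
  have : (Fin.cons (z.1 : CInfty F)⁻¹ t : Fin (s + 1) → CInfty F) ∘ Fin.succ = t :=
    funext fun i => Fin.cons_succ _ _ i
  rw [this, eval_weightSum]
  simp only [pow_one]

lemma norm_coeff_termPoly_oneUnitPow_le (d : ℕ) (y : ℤ_[p]) (k : Fin (s + 1) →₀ ℕ) :
    ‖(termPoly (F := F) s d fun a => oneUnitPow a y).coeff k‖ ≤ decay F p s d := by
  refine norm_coeff_termPoly_le (decay_nonneg s d) (fun k => ?_) k
  simpa using norm_coeff_weightSum_oneUnitPow_le (F := F) (fun _ : Fin s => 1) d y k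

lemma summable_eval_termPoly_and_isEntire (s : ℕ) (y : ℤ_[p]) :
    (∀ t, Summable fun d =>
      MvPolynomial.eval t (termPoly (F := F) s d fun a => oneUnitPow a y)) ∧
      IsEntire fun t => ∑' d,
        MvPolynomial.eval t (termPoly (F := F) s d fun a => oneUnitPow a y) :=
  isEntire_tsum_eval (totalDegree_termPoly_le · _) (norm_coeff_termPoly_oneUnitPow_le · y)
    (isRapidlyDecaying_decay s)

lemma summable_termS (t : Fin s → CInfty F) (z : SInfty F p) : Summable fun d => termS d t z := by
  simp only [termS_eq_eval]
  exact (summable_eval_termPoly_and_isEntire s z.2).1 _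

lemma norm_cons_le {R : ℝ} {t : Fin s → CInfty F} {x : CInfty F} (ht : ∀ i, ‖t i‖ ≤ R)
    (hx : ‖x‖ ≤ R) (i : Fin (s + 1)) : ‖(Fin.cons x t : Fin (s + 1) → CInfty F) i‖ ≤ R :=
  Fin.cases hx ht i

lemma norm_termS_le {R : ℝ} (hR : 1 ≤ R) (d : ℕ) {t : Fin s → CInfty F} {z : SInfty F p}
    (ht : ∀ i, ‖t i‖ ≤ R) (hz : ‖(z.1 : CInfty F)⁻¹‖ ≤ R) :
    ‖termS d t z‖ ≤ decay F p s d * (R ^ (s + 1)) ^ d := by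
  rw [termS_eq_eval, ← pow_mul]
  exact norm_eval_le (totalDegree_termPoly_le d _) (decay_nonneg s d)
    (norm_coeff_termPoly_oneUnitPow_le d z.2) hR (norm_cons_le ht hz)

lemma norm_termS_sub_termS_le {R : ℝ} (hR : 1 ≤ R) (d : ℕ) {t : Fin s → CInfty F}
    {x : (CInfty F)ˣ} (ht : ∀ i, ‖t i‖ ≤ R) (hx : ‖(x : CInfty F)⁻¹‖ ≤ R) {y y' : ℤ_[p]} {m : ℕ}
    (hy : y'.appr m = y.appr m) :
    ‖termS d t (x, y') - termS d t (x, y)‖ ≤ ‖theta F‖⁻¹ ^ p ^ m * (R ^ (s + 1)) ^ d := by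
  rw [termS_eq_eval, termS_eq_eval, ← map_sub, ← termPoly_sub, ← pow_mul]
  have hr : 0 ≤ ‖theta F‖⁻¹ ^ p ^ m := by positivity
  refine norm_eval_le (totalDegree_termPoly_le d _) hr (norm_coeff_termPoly_le hr
    (norm_coeff_weightSum_le _ hr fun a ha => ?_)) hR (norm_cons_le ht hx)
  exact norm_oneUnitPow_sub_oneUnitPow_le (mem_monics.1 ha).1 hy

/-! ### Joint continuity and uniform dependence on `y` -/

lemma continuous_termS (d : ℕ) :
    Continuous fun w : (Fin s → CInfty F) × SInfty F p => termS d w.1 w.2 := by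
  have hx : Continuous fun w : (Fin s → CInfty F) × SInfty F p => ((w.2.1 : CInfty F) ^ d)⁻¹ :=
    ((Units.continuous_val.comp (continuous_fst.comp continuous_snd)).pow d).inv₀
      fun w => pow_ne_zero d w.2.1.ne_zero
  refine hx.mul (continuous_finsetSum _ fun a ha => ?_)
  refine (continuous_finsetProd _ fun i _ => ?_).mul
    ((continuous_oneUnitPow (mem_monics.1 ha).1).comp (continuous_snd.comp continuous_snd))
  exact (a.continuous_eval₂ _).comp ((continuous_apply i).comp continuous_fst)

lemma continuous_LSeries :
    Continuous fun w : (Fin s → CInfty F) × SInfty F p => LSeries w.1 w.2 := by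
  refine continuous_iff_continuousAt.2 fun w₀ => ?_
  obtain ⟨R, hR, ht, hx⟩ : ∃ R : ℝ, 1 ≤ R ∧ ‖w₀.1‖ < R ∧ ‖(w₀.2.1 : CInfty F)⁻¹‖ < R := by
    refine ⟨‖w₀.1‖ + ‖(w₀.2.1 : CInfty F)⁻¹‖ + 1, ?_, ?_, ?_⟩ <;>
      linarith [norm_nonneg w₀.1, norm_nonneg (w₀.2.1 : CInfty F)⁻¹]
  have h1 : ∀ᶠ w : (Fin s → CInfty F) × SInfty F p in 𝓝 w₀, ‖w.1‖ < R :=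
    (continuous_fst.norm.tendsto w₀).eventually_lt_const ht
  have hcont : Continuous fun w : (Fin s → CInfty F) × SInfty F p => ‖(w.2.1 : CInfty F)⁻¹‖ :=
    ((Units.continuous_val.comp (continuous_fst.comp continuous_snd)).inv₀
      fun w => w.2.1.ne_zero).norm
  have h2 := (hcont.tendsto w₀).eventually_lt_const hx
  -- Weierstrass test on a bounded neighbourhood of `w₀`.
  refine ContinuousOn.continuousAt (s := {w : (Fin s → CInfty F) × SInfty F p |
    ‖w.1‖ < R ∧ ‖(w.2.1 : CInfty F)⁻¹‖ < R}) ?_ (h1.and h2)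
  refine continuousOn_tsum (fun d => (continuous_termS d).continuousOn)
    ((isRapidlyDecaying_decay (F := F) (p := p) s).summable (one_le_pow₀ (n := s + 1) hR)) ?_
  exact fun d w hw => norm_termS_le hR d (fun i => (norm_le_pi_norm w.1 i).trans hw.1.le) hw.2.le

lemma tendstoUniformlyOn_LSeries (y : ℤ_[p]) (R : ℝ) :
    TendstoUniformlyOn
      (fun (y' : ℤ_[p]) (w : (Fin s → CInfty F) × (CInfty F)ˣ) => LSeries w.1 (w.2, y'))
      (fun w => LSeries w.1 (w.2, y)) (𝓝 y)
      {w | (∀ i, ‖w.1 i‖ ≤ R) ∧ ‖(w.2 : CInfty F)⁻¹‖ ≤ R} := by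
  wlog hR : 1 ≤ R generalizing R
  · exact (this (max 1 R) (le_max_left _ _)).mono fun w hw =>
      ⟨fun i => (hw.1 i).trans (le_max_right _ _), hw.2.trans (le_max_right _ _)⟩
  refine Metric.tendstoUniformlyOn_iff.2 fun ε hε => ?_
  have hT : 1 ≤ R ^ (s + 1) := one_le_pow₀ hR
  -- Terms with `d ≥ N` are small uniformly in `y`; the modulus `p ^ m` is then chosen to control
  -- the terms with `d ≤ N`.
  obtain ⟨N, hN⟩ := eventually_atTop.1 ((tendsto_decay_mul_pow (F := F) (p := p) s
    hT).eventually_le_const (half_pos hε))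
  have h := (tendsto_inv_norm_theta_pow_pow (p := p) F).mul_const ((R ^ (s + 1)) ^ N)
  rw [zero_mul] at h
  obtain ⟨m, hm⟩ := (h.eventually_le_const (half_pos hε)).exists
  filter_upwards [eventually_appr_eq y m] with y' hy' w hw
  rw [dist_comm, dist_eq_norm]
  refine lt_of_le_of_lt ?_ (half_lt_self hε)
  -- By the ultrametric inequality it suffices to bound each term separately.
  refine norm_tsum_sub_tsum_le (half_pos hε).le (summable_termS _ _) (summable_termS _ _)
    fun d => ?_
  rcases le_total N d with hd | hd
  · exact (norm_sub_le_max_norm _ _).trans (max_le ((norm_termS_le hR d hw.1 hw.2).trans (hN d hd))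
      ((norm_termS_le hR d hw.1 hw.2).trans (hN d hd)))
  · refine (norm_termS_sub_termS_le hR d hw.1 hw.2 hy').trans (le_trans ?_ hm)
    gcongr

lemma isContinuousAnalytic_LSeries :
    IsContinuousAnalytic fun w : (Fin s → CInfty F) × SInfty F p => LSeries w.1 w.2 where
  continuous := continuous_LSeries
  entire y := ⟨_, (summable_eval_termPoly_and_isEntire s y).2, fun t x =>
    tsum_congr fun d => termS_eq_eval d t (x, y)⟩
  family := tendstoUniformlyOn_LSeries

end Main

end GossL

end

theorem mainTheorem10 (F : Type*) [Field F] [Finite F] (p : ℕ) [Fact p.Prime] [CharP F p]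
    (s : ℕ) :
    (∀ (t : Fin s → GossL.CInfty F) (z : GossL.SInfty F p),
      Summable (fun d : ℕ => GossL.termS d t z)) ∧
    GossL.IsContinuousAnalytic
      (fun w : (Fin s → GossL.CInfty F) × GossL.SInfty F p => GossL.LSeries w.1 w.2) ∧
    ∀ (M : Fin s → ℕ) (α : ℕ), 0 < α →
      (∀ t : Fin s → GossL.CInfty F, Summable (fun d : ℕ => GossL.termL M α d t)) ∧
      GossL.IsEntire (fun t : Fin s → GossL.CInfty F => GossL.LValue M α t) :=
  ⟨GossL.summable_termS, GossL.isContinuousAnalytic_LSeries,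
    fun M α _ => GossL.summable_termL_and_isEntire_LValue p M α⟩
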